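/- Let $n\ge 0$ be an integer and let $h(x)=c_0+c_1x+\cdots+c_nx^n\in\mathbb R[x]$ have nonnegative coefficients. For every positive integer $r$ there is a unique polynomial $\mathcal U^n_r(h)\in\mathbb R[x]$ of degree at most $n$ such that $$\frac{\mathcal U^n_r(h)(x)}{(1-x)^n}=\sum_{m\ge 0}a_{rm}x^m \qquad\text{if}\qquad \frac{h(x)}{(1-x)^n}=\sum_{m\ge 0}a_mx^m ,$$ as formal power series. It has the following properties. (a) If $c_0+c_1+\cdots+c_i\le c_n+c_{n-1}+\cdots+c_{n-i}$ for all $0\le i\le\lfloor n/2\rfloor$, then $\mathcal U^n_r(h)$ has a nonnegative, real-rooted symmetric decomposition with respect to $n$ for every positive integer $r\ge n$. (b) If $c_n=0$ and $c_0+c_1+\cdots+c_i\ge c_{n-1}+c_{n-2}+\cdots+c_{n-i}$ for all $1\le i\le\lfloor n/2\rfloor$, then $\mathcal U^n_r(h)$ has a nonnegative, real-rooted symmetric decomposition with respect to $n-1$ for every positive integer $r\ge n$. (If $n=0$, then $h=\mathcal U^0_r(h)=0$, and the decomposition is the zero one.) Here a polynomial $p\in\mathbb R[x]$ of degree at most $d$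 is said to have a nonnegative, real-rooted symmetric decomposition with respect to $d$ if in its unique expression $p(x)=a(x)+x\,b(x)$ with $\deg a\le d$, $\deg b\le d-1$ (so $b=0$ if $d=0$), $a(x)=x^d a(1/x)$ and $b(x)=x^{d-1}b(1/x)$, both $a$ and $b$ have nonnegative coefficients and each of them is either zero or has only real roots. -/

import Mathlib

/-- The `k`-th Veronese `r`-section operator on formal power series,
`∑ a_m x^m ↦ ∑ a_{r m + k} x^m`. -/
noncomputable def veroneseSection (r k : ℕ) (f : PowerSeries ℝ) : PowerSeries ℝ :=
  PowerSeries.mk fun m => PowerSeries.coeff (r * m + k) f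

/-- The formal power series `p(x) / (1 - x)^n`. -/
noncomputable def overOneSubPow (n : ℕ) (p : Polynomial ℝ) : PowerSeries ℝ :=
  (p : PowerSeries ℝ) * ((1 - PowerSeries.X) ^ n)⁻¹

/-- The polynomial `U^n_r(h)` of degree at most `n` defined by
`U^n_r(h) / (1 - x)^n = ∑ a_{r m} x^m` if `h / (1 - x)^n = ∑ a_m x^m`, that is, the coefficients
up to degree `n` of the series `(1 - x)^n ∑ a_{r m} x^m`. For `r ≥ 1` and `deg h ≤ n` this series
has no other nonzero coefficients. -/
noncomputable def edgewiseOp (n r : ℕ) (h : Polynomial ℝ) : Polynomial ℝ :=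
  PowerSeries.trunc (n + 1)
    ((1 - PowerSeries.X) ^ n * veroneseSection r 0 (overOneSubPow n h))

/-- Every complex root of the real polynomial `p` is real, or `p = 0`. -/
def IsRealRooted (p : Polynomial ℝ) : Prop :=
  p = 0 ∨ ∀ z : ℂ, Polynomial.aeval z p = 0 → z.im = 0

/-- All coefficients of `p` are nonnegative. -/
def HasNonnegCoeffs (p : Polynomial ℝ) : Prop :=
  ∀ i, 0 ≤ p.coeff i

/-- `p = a + x b` is the symmetric decomposition of `p` with respect to `n`: `deg a ≤ n`,
`deg b ≤ n - 1` (so `b = 0` if `n = 0`), `a(x) = x^n a(1/x)` and `b(x) = x^(n-1) b(1/x)`. Given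
the degree bound, `Polynomial.reflect n a` is `x^n a(1/x)`. -/
structure IsSymmDecomp (n : ℕ) (p a b : Polynomial ℝ) : Prop where
  eq_add : p = a + Polynomial.X * b
  degree_left : a.degree ≤ n
  degree_right : b.degree < n
  symm_left : a.reflect n = a
  symm_right : b.reflect (n - 1) = b

/-- `p` has a nonnegative, real-rooted symmetric decomposition with respect to `n`. -/
def HasNonnegRealRootedSymmDecomp (n : ℕ) (p : Polynomial ℝ) : Prop :=
  ∃ a b : Polynomial ℝ, IsSymmDecomp n p a b ∧
    HasNonnegCoeffs a ∧ HasNonnegCoeffs b ∧ IsRealRooted a ∧ IsRealRooted b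

open Polynomial in
/-- The polynomials `U^n_r(x^i)`, given by their recursion in `n`. -/
noncomputable def edgewiseMonomial (r : ℕ) : ℕ → ℕ → Polynomial ℝ
  | 0, i => if r ∣ i then X ^ (i / r) else 0
  | n + 1, i => ∑ k ∈ Finset.range r, edgewiseMonomial r n (i + k)

section EdgewiseMonomial

open Polynomial

theorem edgewiseMonomial_add_right {r : ℕ} (hr : 1 ≤ r) (n i : ℕ) :
    edgewiseMonomial r n (i + r) = X * edgewiseMonomial r n i := by
  induction n generalizing i with
  | zero =>
    simp only [edgewiseMonomial, Nat.dvd_add_self_right, Nat.add_div_right i hr]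
    split_ifs <;> simp [pow_succ']
  | succ n ih =>
    simp only [edgewiseMonomial, Finset.mul_sum]
    refine Finset.sum_congr rfl fun k _ => ?_
    rw [← ih, add_right_comm]

theorem edgewiseMonomial_coeff_nonneg (r n i : ℕ) : HasNonnegCoeffs (edgewiseMonomial r n i) := by
  induction n generalizing i with
  | zero =>
    intro j
    simp only [edgewiseMonomial]
    split_ifs
    · rw [coeff_X_pow]; split_ifs <;> norm_num
    · simp
  | succ n ih =>
    intro j
    simp only [edgewiseMonomial, finsetSum_coeff]
    exact Finset.sum_nonneg fun k _ => ih _ j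

theorem edgewiseMonomial_coeff_zero {r : ℕ} (hr : 1 ≤ r) (n : ℕ) {i : ℕ} (hi : 1 ≤ i) :
    (edgewiseMonomial r n i).coeff 0 = 0 := by
  induction n generalizing i with
  | zero =>
    simp only [edgewiseMonomial]
    split_ifs with h
    · have : 0 < i / r := Nat.div_pos (Nat.le_of_dvd hi h) hr
      rw [coeff_X_pow, if_neg this.ne]
    · simp
  | succ n ih =>
    simp only [edgewiseMonomial, finsetSum_coeff]
    exact Finset.sum_eq_zero fun k _ => ih (by omega)

theorem edgewiseMonomial_natDegree_le {r : ℕ} (hr : 1 ≤ r) (n i d : ℕ)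
    (h : i + n * (r - 1) ≤ r * d) : (edgewiseMonomial r n i).natDegree ≤ d := by
  induction n generalizing i with
  | zero =>
    simp only [edgewiseMonomial]
    split_ifs
    · rw [natDegree_X_pow]
      exact Nat.div_le_of_le_mul (by omega)
    · simp
  | succ n ih =>
    simp only [edgewiseMonomial]
    refine natDegree_sum_le_of_forall_le _ _ fun k hk => ih _ ?_
    have := Finset.mem_range.1 hk
    rw [Nat.succ_mul] at h
    omega

theorem reflect_sum {ι : Type*} (N : ℕ) (s : Finset ι) (f : ι → ℝ[X]) :
    (∑ i ∈ s, f i).reflect N = ∑ i ∈ s, (f i).reflect N := by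
  ext j
  simp [coeff_reflect]

theorem edgewiseMonomial_reflect {r : ℕ} (hr : 1 ≤ r) (n i j d : ℕ)
    (h : i + j + n * (r - 1) = r * d) :
    (edgewiseMonomial r n i).reflect d = edgewiseMonomial r n j := by
  induction n generalizing i j with
  | zero =>
    simp only [edgewiseMonomial]
    have h' : i + j = r * d := by simpa using h
    by_cases hi : r ∣ i
    · obtain ⟨a, rfl⟩ := hi
      have had : a ≤ d := Nat.le_of_mul_le_mul_left (by omega) hr
      obtain rfl : j = r * (d - a) := by rw [Nat.mul_sub]; omega
      rw [if_pos (dvd_mul_right _ _), if_pos (dvd_mul_right _ _), Nat.mul_div_cancel_left _ hr,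
        Nat.mul_div_cancel_left _ hr, reflect_monomial, revAt_le had]
    · have hj : ¬ r ∣ j := fun hj => hi ((Nat.dvd_add_left hj).1 (h' ▸ dvd_mul_right r d))
      simp [hi, hj]
  | succ n ih =>
    simp only [edgewiseMonomial]
    rw [reflect_sum, ← Finset.sum_range_reflect]
    refine Finset.sum_congr rfl fun k hk => ih _ _ ?_
    have := Finset.mem_range.1 hk
    rw [Nat.succ_mul] at h
    omega

end EdgewiseMonomial

section Series

theorem veroneseSection_sum {ι : Type*} (r k : ℕ) (s : Finset ι) (f : ι → PowerSeries ℝ) :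
    veroneseSection r k (∑ i ∈ s, f i) = ∑ i ∈ s, veroneseSection r k (f i) := by
  ext m; simp [veroneseSection]

theorem veroneseSection_C_mul (r k : ℕ) (c : ℝ) (f : PowerSeries ℝ) :
    veroneseSection r k (PowerSeries.C c * f) = PowerSeries.C c * veroneseSection r k f := by
  ext m; simp [veroneseSection]

theorem veroneseSection_one_sub_X_pow_mul {r : ℕ} (hr : 1 ≤ r) (f : PowerSeries ℝ) :
    veroneseSection r 0 ((1 - PowerSeries.X ^ r) * f) =
      (1 - PowerSeries.X) * veroneseSection r 0 f := by
  ext m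
  simp only [veroneseSection, sub_mul, one_mul, PowerSeries.coeff_mk, map_sub, add_zero,
    PowerSeries.coeff_X_pow_mul']
  cases m with
  | zero => simp; omega
  | succ m =>
    rw [PowerSeries.coeff_succ_X_mul, PowerSeries.coeff_mk, if_pos (by nlinarith), Nat.mul_succ,
      Nat.add_sub_cancel]

theorem one_sub_X_pow_mul_inv (n : ℕ) :
    (1 - PowerSeries.X : PowerSeries ℝ) ^ n * ((1 - PowerSeries.X) ^ n)⁻¹ = 1 :=
  PowerSeries.mul_inv_cancel _ (by simp)

theorem one_sub_X_pow_mul_overOneSubPow (n : ℕ) (p : Polynomial ℝ) :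
    (1 - PowerSeries.X : PowerSeries ℝ) ^ n * overOneSubPow n p = p := by
  rw [overOneSubPow, mul_left_comm, one_sub_X_pow_mul_inv, mul_one]

theorem overOneSubPow_injective (n : ℕ) : Function.Injective (overOneSubPow n) := by
  intro p q h
  rw [← Polynomial.coe_inj, ← one_sub_X_pow_mul_overOneSubPow n p, h,
    one_sub_X_pow_mul_overOneSubPow]

theorem eq_of_one_sub_X_mul_eq {f g : PowerSeries ℝ}
    (h : (1 - PowerSeries.X) * f = (1 - PowerSeries.X) * g) : f = g := by
  refine mul_left_cancel₀ ?_ h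
  intro h0
  simpa using congrArg PowerSeries.constantCoeff h0

theorem one_sub_X_mul_overOneSubPow_succ (n : ℕ) (p : Polynomial ℝ) :
    (1 - PowerSeries.X) * overOneSubPow (n + 1) p = overOneSubPow n p := by
  have h0 : ((1 - PowerSeries.X : PowerSeries ℝ) ^ n) ≠ 0 := by
    intro h0
    simpa using congrArg PowerSeries.constantCoeff h0
  refine mul_left_cancel₀ h0 ?_
  rw [one_sub_X_pow_mul_overOneSubPow, ← mul_assoc, ← pow_succ, one_sub_X_pow_mul_overOneSubPow]

theorem overOneSubPow_sum {ι : Type*} (n : ℕ) (s : Finset ι) (f : ι → Polynomial ℝ) :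
    overOneSubPow n (∑ i ∈ s, f i) = ∑ i ∈ s, overOneSubPow n (f i) := by
  have : ((∑ i ∈ s, f i : Polynomial ℝ) : PowerSeries ℝ) = ∑ i ∈ s, (f i : PowerSeries ℝ) :=
    map_sum (Polynomial.coeToPowerSeries.ringHom) f s
  rw [overOneSubPow, this, Finset.sum_mul]
  rfl

theorem overOneSubPow_C_mul (n : ℕ) (c : ℝ) (p : Polynomial ℝ) :
    overOneSubPow n (Polynomial.C c * p) = PowerSeries.C c * overOneSubPow n p := by
  simp [overOneSubPow, mul_assoc]

theorem veroneseSection_overOneSubPow_X_pow {r : ℕ} (hr : 1 ≤ r) (n i : ℕ) :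
    veroneseSection r 0 (overOneSubPow n (Polynomial.X ^ i)) =
      overOneSubPow n (edgewiseMonomial r n i) := by
  induction n generalizing i with
  | zero =>
    ext m
    simp only [veroneseSection, overOneSubPow, edgewiseMonomial, pow_zero, inv_one, mul_one,
      PowerSeries.coeff_mk, Polynomial.coeff_coe, Polynomial.coeff_X_pow, add_zero]
    split_ifs with h2 h3 h3
    · subst h2; simp [Nat.mul_div_cancel_left _ hr]
    · exact absurd ⟨m, h2.symm⟩ h3
    · obtain ⟨a, rfl⟩ := h3
      rw [Nat.mul_div_cancel_left _ hr, Polynomial.coeff_X_pow, if_neg]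
      rintro rfl; exact h2 rfl
    · simp
  | succ n ih =>
    refine eq_of_one_sub_X_mul_eq ?_
    have key : (1 - PowerSeries.X ^ r) * overOneSubPow (n + 1) (Polynomial.X ^ i) =
        ∑ k ∈ Finset.range r, overOneSubPow n (Polynomial.X ^ (i + k)) := by
      have hg : (1 - PowerSeries.X ^ r : PowerSeries ℝ) =
          (∑ k ∈ Finset.range r, PowerSeries.X ^ k) * (1 - PowerSeries.X) :=
        (geom_sum_mul_neg _ _).symm
      rw [hg, mul_assoc, one_sub_X_mul_overOneSubPow_succ, Finset.sum_mul]
      refine Finset.sum_congr rfl fun k _ => ?_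
      simp only [overOneSubPow, Polynomial.coe_pow, Polynomial.coe_X]
      ring
    rw [← veroneseSection_one_sub_X_pow_mul hr, key, one_sub_X_mul_overOneSubPow_succ,
      veroneseSection_sum, edgewiseMonomial, overOneSubPow_sum]
    exact Finset.sum_congr rfl fun k _ => ih _

theorem overOneSubPow_sum_edgewiseMonomial {r : ℕ} (hr : 1 ≤ r) {n : ℕ} {h : Polynomial ℝ}
    (hdeg : h.degree ≤ n) :
    overOneSubPow n (∑ j ∈ Finset.range (n + 1),
      Polynomial.C (h.coeff j) * edgewiseMonomial r n j) =
      veroneseSection r 0 (overOneSubPow n h) := by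
  conv_rhs => rw [h.as_sum_range_C_mul_X_pow' (Nat.lt_succ_of_le
    (Polynomial.natDegree_le_of_degree_le hdeg))]
  simp only [overOneSubPow_sum, veroneseSection_sum, overOneSubPow_C_mul, veroneseSection_C_mul,
    veroneseSection_overOneSubPow_X_pow hr]

theorem sum_edgewiseMonomial_natDegree_le {r : ℕ} (hr : 1 ≤ r) (n : ℕ) (c : ℕ → ℝ) :
    (∑ j ∈ Finset.range (n + 1), Polynomial.C (c j) * edgewiseMonomial r n j).natDegree ≤ n := by
  refine Polynomial.natDegree_sum_le_of_forall_le _ _ fun j hj => ?_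
  refine (Polynomial.natDegree_C_mul_le _ _).trans (edgewiseMonomial_natDegree_le hr n j n ?_)
  have := Finset.mem_range.1 hj
  obtain ⟨q, rfl⟩ := Nat.exists_eq_add_of_le' hr
  rw [Nat.add_sub_cancel]
  nlinarith

theorem edgewiseOp_eq_sum {r : ℕ} (hr : 1 ≤ r) {n : ℕ} {h : Polynomial ℝ}
    (hdeg : h.degree ≤ n) :
    edgewiseOp n r h =
      ∑ j ∈ Finset.range (n + 1), Polynomial.C (h.coeff j) * edgewiseMonomial r n j := by
  rw [edgewiseOp, ← overOneSubPow_sum_edgewiseMonomial hr hdeg, one_sub_X_pow_mul_overOneSubPow]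
  exact PowerSeries.trunc_coe_eq_self
    (Nat.lt_succ_of_le (sum_edgewiseMonomial_natDegree_le hr n h.coeff))

end Series

section Sector

open ComplexConjugate

/-- A sequence of complex numbers with `u (i + r) = z * u i` for which each `u j` with
`i ≤ j ≤ i + r` lies in the sector bounded by `u i` and `z * u i`. -/
structure IsSectorial (z : ℂ) (r : ℕ) (u : ℕ → ℂ) : Prop where
  add_right : ∀ i, u (i + r) = z * u i
  im_nonneg : ∀ i j, i ≤ j → j ≤ i + r → 0 ≤ (u j * conj (u i)).im

theorem im_sum_mul_conj_sum {ι κ : Type*} (s : Finset ι) (t : Finset κ) (f : ι → ℂ) (g : κ → ℂ) :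
    ((∑ i ∈ s, f i) * conj (∑ k ∈ t, g k)).im = ∑ i ∈ s, ∑ k ∈ t, (f i * conj (g k)).im := by
  simp [map_sum, Finset.sum_mul_sum, Complex.im_sum]

theorem im_mul_self_conj (z w : ℂ) : (z * w * conj w).im = z.im * Complex.normSq w := by
  rw [mul_assoc, Complex.mul_conj, Complex.im_mul_ofReal]

theorem im_mul_conj_comm (z w : ℂ) : (z * conj w).im = -(w * conj z).im := by
  simp; ring

namespace IsSectorial

variable {z : ℂ} {r : ℕ} {u : ℕ → ℂ}

theorem im_mul_nonneg (hu : IsSectorial z r u) {i j : ℕ} (hij : i ≤ j) (hj : j ≤ i + r) :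
    0 ≤ (z * u i * conj (u j)).im := by
  rw [← hu.add_right]
  exact hu.im_nonneg _ _ hj (by omega)

theorem windowSum (hu : IsSectorial z r u) (hz : 0 < z.im) :
    IsSectorial z r fun i => ∑ k ∈ Finset.range r, u (i + k) := by
  refine ⟨fun i => ?_, fun i j hij hj => ?_⟩
  · rw [Finset.mul_sum]
    exact Finset.sum_congr rfl fun k _ => by rw [add_right_comm, hu.add_right]
  · obtain ⟨l, rfl⟩ := Nat.exists_eq_add_of_le hij
    obtain ⟨q, rfl⟩ : ∃ q, r = l + q := Nat.exists_eq_add_of_le (by omega)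
    have h1 : ∑ k ∈ Finset.range (l + q), u (i + k) =
        ∑ k ∈ Finset.range l, u (i + k) + ∑ k ∈ Finset.range q, u (i + l + k) := by
      simp [Finset.sum_range_add, add_assoc]
    have h2 : ∑ k ∈ Finset.range (l + q), u (i + l + k) =
        ∑ k ∈ Finset.range q, u (i + l + k) + z * ∑ k ∈ Finset.range l, u (i + k) := by
      rw [add_comm l q, Finset.sum_range_add, Finset.mul_sum]
      congr 1
      refine Finset.sum_congr rfl fun k _ => ?_
      rw [← hu.add_right]
      congr 1; omega
    simp only [h1, h2]
    set s := ∑ k ∈ Finset.range l, u (i + k) with hs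
    set t := ∑ k ∈ Finset.range q, u (i + l + k) with ht
    have e1 : 0 ≤ (t * conj s).im := by
      rw [hs, ht, im_sum_mul_conj_sum]
      refine Finset.sum_nonneg fun a ha => Finset.sum_nonneg fun b hb => ?_
      rw [Finset.mem_range] at ha hb
      exact hu.im_nonneg _ _ (by omega) (by omega)
    have e2 : 0 ≤ (z * s * conj t).im := by
      rw [hs, ht, Finset.mul_sum, im_sum_mul_conj_sum]
      refine Finset.sum_nonneg fun a ha => Finset.sum_nonneg fun b hb => ?_
      rw [Finset.mem_range] at ha hb
      exact hu.im_mul_nonneg (by omega) (by omega)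
    have e3 : ((t + z * s) * conj (s + t)).im =
        (t * conj s).im + (z * s * conj t).im + z.im * Complex.normSq s +
          (t * conj t).im := by
      rw [← im_mul_self_conj, ← Complex.add_im, ← Complex.add_im, ← Complex.add_im, map_add]
      congr 1; ring
    rw [e3, Complex.mul_conj, Complex.ofReal_im]
    have := mul_nonneg hz.le (Complex.normSq_nonneg s)
    linarith

theorem eq_zero_of_sum_eq_zero (hu : IsSectorial z r u) (hz : 0 < z.im) {i : ℕ} {c : ℕ → ℝ}
    (hc : ∀ k, 0 ≤ c k) {q : ℕ} (hq : q ≤ r)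
    (h : ∑ k ∈ Finset.range q, (c k : ℂ) * u (i + k) = 0) :
    ∀ k < q, (c k : ℂ) * u (i + k) = 0 := by
  induction q with
  | zero => simp
  | succ q ih =>
    rw [Finset.sum_range_succ] at h
    set s := ∑ k ∈ Finset.range q, (c k : ℂ) * u (i + k) with hs
    have e : 0 ≤ (z * s * conj ((c q : ℂ) * u (i + q))).im := by
      have : z * s * conj ((c q : ℂ) * u (i + q)) =
          ∑ k ∈ Finset.range q, ((c k * c q : ℝ) : ℂ) * (z * u (i + k) * conj (u (i + q))) := by
        rw [hs, Finset.mul_sum, Finset.sum_mul]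
        refine Finset.sum_congr rfl fun k _ => ?_
        simp; ring
      rw [this, Complex.im_sum]
      refine Finset.sum_nonneg fun k hk => ?_
      rw [Finset.mem_range] at hk
      rw [Complex.im_ofReal_mul]
      exact mul_nonneg (mul_nonneg (hc _) (hc _)) (hu.im_mul_nonneg (by omega) (by omega))
    have hs' : (c q : ℂ) * u (i + q) = -s := by linear_combination h
    rw [hs', map_neg, mul_neg, Complex.neg_im, im_mul_self_conj] at e
    have h0 : s = 0 := by
      by_contra hne
      have := mul_pos hz (Complex.normSq_pos.2 hne)
      linarith
    intro k hk
    rcases Nat.lt_succ_iff_lt_or_eq.1 hk with hk | rfl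
    · exact ih (by omega) h0 k hk
    · rw [hs', h0, neg_zero]

theorem im_sum_mul_conj_sum_nonneg (hu : IsSectorial z r u) {f g : ℕ → ℝ}
    (hf : Monotone f) (hg : Antitone g) (hf0 : ∀ k, 0 ≤ f k) (hg0 : ∀ k, 0 ≤ g k) :
    0 ≤ ((∑ k ∈ Finset.range r, (f k : ℂ) * u k) *
      conj (∑ k ∈ Finset.range r, (g k : ℂ) * u k)).im := by
  rw [im_sum_mul_conj_sum]
  have key : ∀ a b : ℕ, (f a * u a * conj (g b * u b)).im = f a * g b * (u a * conj (u b)).im := by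
    intro a b
    rw [← Complex.im_ofReal_mul]
    congr 1
    simp; ring
  simp only [key]
  have hsymm : ∑ a ∈ Finset.range r, ∑ b ∈ Finset.range r, f a * g b * (u a * conj (u b)).im =
      ∑ a ∈ Finset.range r, ∑ b ∈ Finset.range r, -(f b * g a * (u a * conj (u b)).im) := by
    rw [Finset.sum_comm]
    refine Finset.sum_congr rfl fun a _ => Finset.sum_congr rfl fun b _ => ?_
    rw [im_mul_conj_comm (u b)]
    ring
  have hpos : 0 ≤ ∑ a ∈ Finset.range r, ∑ b ∈ Finset.range r,
      (f a * g b - f b * g a) * (u a * conj (u b)).im := by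
    refine Finset.sum_nonneg fun a ha => Finset.sum_nonneg fun b hb => ?_
    rw [Finset.mem_range] at ha hb
    rcases le_total b a with h | h
    · refine mul_nonneg ?_ (hu.im_nonneg _ _ h (by omega))
      have := mul_le_mul (hf h) (hg h) (hg0 _) (hf0 _)
      linarith
    · refine mul_nonneg_of_nonpos_of_nonpos ?_ ?_
      · have := mul_le_mul (hf h) (hg h) (hg0 _) (hf0 _)
        linarith
      · rw [im_mul_conj_comm]
        have := hu.im_nonneg _ _ h (by omega)
        linarith
  have hsum : ∑ a ∈ Finset.range r, ∑ b ∈ Finset.range r,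
      (f a * g b - f b * g a) * (u a * conj (u b)).im =
      ∑ a ∈ Finset.range r, ∑ b ∈ Finset.range r, f a * g b * (u a * conj (u b)).im +
      ∑ a ∈ Finset.range r, ∑ b ∈ Finset.range r, -(f b * g a * (u a * conj (u b)).im) := by
    simp only [← Finset.sum_add_distrib]
    refine Finset.sum_congr rfl fun a _ => Finset.sum_congr rfl fun b _ => ?_
    ring
  linarith

end IsSectorial

open Polynomial

theorem isSectorial_edgewiseMonomial {z : ℂ} (hz : 0 < z.im) {r : ℕ} (hr : 1 ≤ r) (n : ℕ) :
    IsSectorial z r fun i => aeval z (edgewiseMonomial r n i) := by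
  induction n with
  | zero =>
    refine ⟨fun i => by simp [edgewiseMonomial_add_right hr], fun i j hij hj => ?_⟩
    simp only [edgewiseMonomial]
    by_cases hi : r ∣ i
    · by_cases hj' : r ∣ j
      · obtain ⟨a, rfl⟩ := hi
        obtain ⟨b, rfl⟩ := hj'
        have h1 : a ≤ b := Nat.le_of_mul_le_mul_left hij hr
        have h2 : b ≤ a + 1 := Nat.le_of_mul_le_mul_left (by rw [Nat.mul_succ]; exact hj) hr
        simp only [dvd_mul_right, if_true, Nat.mul_div_cancel_left _ (show 0 < r from hr), map_pow,
          aeval_X]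
        rcases h1.eq_or_lt with rfl | h1
        · rw [← map_pow, Complex.mul_conj, Complex.ofReal_im]
        · obtain rfl : b = a + 1 := by omega
          rw [pow_succ', ← map_pow, im_mul_self_conj]
          exact mul_nonneg hz.le (Complex.normSq_nonneg _)
      · simp [hj']
    · simp [hi]
  | succ n ih => simpa [edgewiseMonomial] using ih.windowSum hz

theorem edgewiseMonomial_eq_zero_of_aeval_eq_zero {z : ℂ} (hz : 0 < z.im) {r : ℕ} (hr : 1 ≤ r)
    (n i : ℕ) (h : aeval z (edgewiseMonomial r n i) = 0) : edgewiseMonomial r n i = 0 := by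
  induction n generalizing i with
  | zero =>
    simp only [edgewiseMonomial] at h ⊢
    split_ifs with hi
    · rw [if_pos hi, map_pow, aeval_X] at h
      have : z = 0 := eq_zero_of_pow_eq_zero h
      simp [this] at hz
    · rfl
  | succ n ih =>
    simp only [edgewiseMonomial, map_sum] at h ⊢
    refine Finset.sum_eq_zero fun k hk => ih _ ?_
    have := (isSectorial_edgewiseMonomial hz hr n).eq_zero_of_sum_eq_zero hz (i := i)
      (c := fun _ => 1) (by simp) le_rfl (by simpa using h) k (Finset.mem_range.1 hk)
    simpa using this

theorem C_mul_edgewiseMonomial_eq_zero {z : ℂ} (hz : 0 < z.im) {r : ℕ} (hr : 1 ≤ r)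
    {n i : ℕ} {c : ℝ} (h : (c : ℂ) * aeval z (edgewiseMonomial r n i) = 0) :
    C c * edgewiseMonomial r n i = 0 := by
  rcases mul_eq_zero.1 h with h | h
  · rw [Complex.ofReal_eq_zero.1 h, C_0, zero_mul]
  · rw [edgewiseMonomial_eq_zero_of_aeval_eq_zero hz hr n i h, mul_zero]

theorem isRealRooted_of_upperHalfPlane {p : ℝ[X]}
    (h : ∀ z : ℂ, 0 < z.im → aeval z p = 0 → p = 0) : IsRealRooted p := by
  by_cases hp : p = 0
  · exact Or.inl hp
  refine Or.inr fun z hz => ?_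
  rcases lt_trichotomy z.im 0 with h0 | h0 | h0
  · refine absurd (h (conj z) (by simpa using h0) ?_) hp
    rw [aeval_conj, hz, map_zero]
  · exact h0
  · exact absurd (h z h0 hz) hp

theorem isRealRooted_sum_edgewiseMonomial {r : ℕ} (hr : 1 ≤ r) (n : ℕ) {f g : ℕ → ℝ}
    (hf : Monotone f) (hg : Antitone g) (hf0 : ∀ k, 0 ≤ f k) (hg0 : ∀ k, 0 ≤ g k) :
    IsRealRooted (∑ i ∈ Finset.range r, (C (f i) + C (g i) * X) * edgewiseMonomial r n i) := by
  refine isRealRooted_of_upperHalfPlane fun z hz h => ?_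
  have hu := isSectorial_edgewiseMonomial hz hr n
  have hnn := hu.im_sum_mul_conj_sum_nonneg hf hg hf0 hg0
  set F := ∑ k ∈ Finset.range r, (f k : ℂ) * aeval z (edgewiseMonomial r n k) with hF
  set G := ∑ k ∈ Finset.range r, (g k : ℂ) * aeval z (edgewiseMonomial r n k) with hG
  have hsum : F + z * G = 0 := by
    rw [← h, hF, hG, Finset.mul_sum, ← Finset.sum_add_distrib, map_sum]
    refine Finset.sum_congr rfl fun k _ => ?_
    simp; ring
  have hFG : F = -(z * G) := by linear_combination hsum
  rw [hFG, neg_mul, Complex.neg_im, im_mul_self_conj] at hnn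
  have hG0 : G = 0 := by
    by_contra hne
    have := mul_pos hz (Complex.normSq_pos.2 hne)
    linarith
  have hF0 : F = 0 := by rw [hFG, hG0, mul_zero, neg_zero]
  refine Finset.sum_eq_zero fun k hk => ?_
  have hk' := Finset.mem_range.1 hk
  have h1 := hu.eq_zero_of_sum_eq_zero hz (i := 0) hf0 le_rfl (by simpa using hF0) k hk'
  have h2 := hu.eq_zero_of_sum_eq_zero hz (i := 0) hg0 le_rfl (by simpa using hG0) k hk'
  simp only [zero_add] at h1 h2
  rw [add_mul, mul_right_comm, C_mul_edgewiseMonomial_eq_zero hz hr h1,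
    C_mul_edgewiseMonomial_eq_zero hz hr h2, zero_mul, zero_add]

theorem isRealRooted_sum_C_mul_edgewiseMonomial {r : ℕ} (hr : 1 ≤ r) (n : ℕ) {c : ℕ → ℝ}
    (hc : ∀ k, 0 ≤ c k) :
    IsRealRooted (∑ i ∈ Finset.range r, C (c i) * edgewiseMonomial r n i) := by
  refine isRealRooted_of_upperHalfPlane fun z hz h => Finset.sum_eq_zero fun k hk => ?_
  have := (isSectorial_edgewiseMonomial hz hr n).eq_zero_of_sum_eq_zero hz (i := 0) hc le_rfl
    (by simpa using h) k (Finset.mem_range.1 hk)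
  exact C_mul_edgewiseMonomial_eq_zero hz hr (by simpa using this)

end Sector

section SymmetricDecomposition

open Polynomial Finset

theorem sum_edgewiseMonomial_add {r : ℕ} (hr : 1 ≤ r) (n j : ℕ) (hj : j ≤ r) :
    ∑ k ∈ range r, edgewiseMonomial r n (j + k) =
      ∑ i ∈ range r, (if j ≤ i then edgewiseMonomial r n i else X * edgewiseMonomial r n i) := by
  obtain ⟨q, rfl⟩ := Nat.exists_eq_add_of_le hj
  rw [sum_range_add (fun i => if j ≤ i then _ else _), add_comm j q, sum_range_add, add_comm]
  congr 1
  · refine sum_congr rfl fun k hk => ?_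
    rw [if_neg (by simpa using hk), ← edgewiseMonomial_add_right (by omega)]
    congr 1; omega
  · refine sum_congr rfl fun k _ => ?_
    rw [if_pos (by omega)]

theorem sum_C_mul_edgewiseMonomial_succ {n r : ℕ} (hr : 1 ≤ r) (hnr : n + 1 ≤ r) (c : ℕ → ℝ)
    (hc : ∀ j, n + 1 < j → c j = 0) :
    ∑ j ∈ range (n + 2), C (c j) * edgewiseMonomial r (n + 1) j =
      ∑ i ∈ range r, (C (∑ j ∈ range (i + 1), c j) +
        C (∑ j ∈ range (n + 2), c j - ∑ j ∈ range (i + 1), c j) * X) *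
          edgewiseMonomial r n i := by
  have hsplit : ∀ i, ∑ j ∈ range (n + 2), (if j ≤ i then c j else 0) =
      ∑ j ∈ range (i + 1), c j := by
    intro i
    rw [← sum_filter]
    refine sum_subset_zero_on_sdiff (fun j hj => ?_) (fun j hj => ?_) fun _ _ => rfl
    · simp only [mem_filter, mem_range] at hj ⊢; omega
    · simp only [mem_sdiff, mem_filter, mem_range] at hj
      exact hc j (by omega)
  have hrow : ∀ j ∈ range (n + 2), C (c j) * edgewiseMonomial r (n + 1) j =
      ∑ i ∈ range r, (C (if j ≤ i then c j else 0) + C (c j - if j ≤ i then c j else 0) * X) *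
        edgewiseMonomial r n i := by
    intro j hj
    rw [mem_range] at hj
    rw [edgewiseMonomial, sum_edgewiseMonomial_add hr n j (by omega), mul_sum]
    refine sum_congr rfl fun i _ => ?_
    split_ifs <;> simp [mul_assoc]
  rw [sum_congr rfl hrow, sum_comm]
  refine sum_congr rfl fun i _ => ?_
  rw [← sum_mul, sum_add_distrib, ← sum_mul, ← map_sum, ← map_sum, sum_sub_distrib, hsplit]

theorem natDegree_sum_edgewiseMonomial_le {n r : ℕ} (hnr : n + 1 ≤ r) {f g : ℕ → ℝ}
    (hg : ∀ i, n + 1 ≤ i → g i = 0) :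
    (∑ i ∈ range r, (C (f i) + C (g i) * X) * edgewiseMonomial r n i).natDegree ≤ n + 1 := by
  obtain ⟨q, rfl⟩ := Nat.exists_eq_add_of_le' (show 1 ≤ r by omega)
  refine natDegree_sum_le_of_forall_le _ _ fun i hi => ?_
  rw [mem_range] at hi
  rw [add_mul, mul_assoc]
  refine (natDegree_add_le _ _).trans (max_le ?_ ?_)
  · refine (natDegree_C_mul_le _ _).trans (edgewiseMonomial_natDegree_le (by omega) _ _ _ ?_)
    rw [Nat.add_sub_cancel]; nlinarith
  · rcases lt_or_ge i (n + 1) with h | h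
    · rw [← edgewiseMonomial_add_right (by omega)]
      refine (natDegree_C_mul_le _ _).trans (edgewiseMonomial_natDegree_le (by omega) _ _ _ ?_)
      rw [Nat.add_sub_cancel]; nlinarith
    · simp [hg i h]

theorem reflect_sum_edgewiseMonomial {n r : ℕ} (hnr : n + 1 ≤ r) {f g : ℕ → ℝ}
    (hfg : ∀ i ≤ n, g i = f (n - i)) (hg : ∀ i, n + 1 ≤ i → g i = 0)
    (hf : ∀ i, n + 1 ≤ i → f i = f (n + 1)) :
    (∑ i ∈ range r, (C (f i) + C (g i) * X) * edgewiseMonomial r n i).reflect (n + 1) =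
      ∑ i ∈ range r, (C (f i) + C (g i) * X) * edgewiseMonomial r n i := by
  have hr : 1 ≤ r := by omega
  have hw : ∑ i ∈ range r, (C (f i) + C (g i) * X) * edgewiseMonomial r n i =
      ∑ i ∈ range (r + (n + 1)), C (f (min i (r + n - i))) * edgewiseMonomial r n i := by
    rw [sum_range_add]
    simp only [add_mul, sum_add_distrib]
    congr 1
    · refine sum_congr rfl fun i hi => ?_
      rw [mem_range] at hi
      rcases le_total i (r + n - i) with h | h
      · rw [min_eq_left h]
      · rw [min_eq_right h]
        rcases lt_or_ge i (n + 1) with h' | h'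
        · rw [show r + n - i = i by omega]
        · rcases lt_or_ge (r + n - i) (n + 1) with h'' | h''
          · omega
          · rw [hf _ h', hf _ h'']
    · obtain ⟨q, rfl⟩ := Nat.exists_eq_add_of_le hnr
      rw [sum_range_add _ (n + 1) q, add_eq_left.2]
      · refine sum_congr rfl fun i hi => ?_
        rw [mem_range] at hi
        rw [mul_assoc, ← edgewiseMonomial_add_right hr, hfg i (by omega), add_comm i]
        congr 3
        omega
      · exact sum_eq_zero fun i _ => by rw [hg _ (by omega)]; simp
  rw [hw, reflect_sum]
  conv_rhs => rw [← sum_range_reflect]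
  refine sum_congr rfl fun i hi => ?_
  rw [mem_range] at hi
  obtain ⟨q, rfl⟩ := Nat.exists_eq_add_of_le' hr
  rw [reflect_C_mul, edgewiseMonomial_reflect hr n i (q + 1 + (n + 1) - 1 - i) (n + 1)]
  · congr 3
    omega
  · have : i + (q + 1 + (n + 1) - 1 - i) = q + 1 + n := by omega
    rw [this, Nat.add_sub_cancel]; ring

theorem reflect_sum_C_mul_edgewiseMonomial {n r : ℕ} (hnr : n + 1 ≤ r) {c : ℕ → ℝ}
    (hsymm : ∀ i ≤ n, c (n - i) = c i) (hc : ∀ i, n + 1 ≤ i → c i = 0) :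
    (∑ i ∈ range r, C (c i) * edgewiseMonomial r n i).reflect n =
      ∑ i ∈ range r, C (c i) * edgewiseMonomial r n i := by
  have hr : 1 ≤ r := by omega
  have hw : ∑ i ∈ range r, C (c i) * edgewiseMonomial r n i =
      ∑ i ∈ range (n + 1), C (c i) * edgewiseMonomial r n i := by
    refine (sum_subset (range_mono hnr) fun i _ hi => ?_).symm
    rw [mem_range, not_lt] at hi
    rw [hc i hi, C_0, zero_mul]
  rw [hw, reflect_sum]
  conv_rhs => rw [← sum_range_reflect]
  refine sum_congr rfl fun i hi => ?_
  rw [mem_range] at hi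
  obtain ⟨q, rfl⟩ := Nat.exists_eq_add_of_le' hr
  rw [reflect_C_mul, Nat.add_sub_cancel, hsymm i (by omega),
    edgewiseMonomial_reflect hr n i (n - i) n]
  rw [Nat.add_sub_cancel, Nat.add_sub_cancel' (by omega)]; ring

theorem natDegree_sum_C_mul_edgewiseMonomial_le {n r : ℕ} (hr : 1 ≤ r) {c : ℕ → ℝ}
    (hc : ∀ i, n + 1 ≤ i → c i = 0) :
    (∑ i ∈ range r, C (c i) * edgewiseMonomial r n i).natDegree ≤ n := by
  obtain ⟨q, rfl⟩ := Nat.exists_eq_add_of_le' hr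
  refine natDegree_sum_le_of_forall_le _ _ fun i _ => ?_
  rcases lt_or_ge i (n + 1) with h | h
  · refine (natDegree_C_mul_le _ _).trans (edgewiseMonomial_natDegree_le hr _ _ _ ?_)
    rw [Nat.add_sub_cancel]; nlinarith
  · simp [hc i h]

theorem HasNonnegCoeffs.sum {ι : Type*} {s : Finset ι} {f : ι → ℝ[X]}
    (h : ∀ i ∈ s, HasNonnegCoeffs (f i)) : HasNonnegCoeffs (∑ i ∈ s, f i) := by
  intro j
  rw [finsetSum_coeff]
  exact sum_nonneg fun i hi => h i hi j

theorem HasNonnegCoeffs.C_mul {p : ℝ[X]} (hp : HasNonnegCoeffs p) {c : ℝ} (hc : 0 ≤ c) :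
    HasNonnegCoeffs (C c * p) := by
  intro j
  rw [coeff_C_mul]
  exact mul_nonneg hc (hp j)

theorem HasNonnegCoeffs.linear_mul {p : ℝ[X]} (hp : HasNonnegCoeffs p) {c d : ℝ} (hc : 0 ≤ c)
    (hd : 0 ≤ d) : HasNonnegCoeffs ((C c + C d * X) * p) := by
  intro j
  rw [add_mul, mul_assoc, coeff_add, coeff_C_mul, coeff_C_mul]
  refine add_nonneg (mul_nonneg hc (hp j)) (mul_nonneg hd ?_)
  cases j with
  | zero => simp
  | succ j => rw [coeff_X_mul]; exact hp j

/-- Removing the factor `X` from a polynomial that is symmetric with respect to `n + 1`. -/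
theorem reflect_divX {n : ℕ} {y : ℝ[X]} (hdeg : y.natDegree ≤ n + 1)
    (hsymm : y.reflect (n + 1) = y) (h0 : y.coeff 0 = 0) :
    y.divX.degree < n ∧ y.divX.reflect (n - 1) = y.divX := by
  have hco : ∀ i ≤ n + 1, y.coeff (n + 1 - i) = y.coeff i := by
    intro i hi
    conv_rhs => rw [← hsymm, coeff_reflect, revAt_le hi]
  have hlt : ∀ i, n ≤ i → y.divX.coeff i = 0 := by
    intro i hi
    rw [coeff_divX]
    rcases hi.eq_or_lt with rfl | hi
    · rw [← h0, ← hco 0 (by omega), Nat.sub_zero]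
    · exact coeff_eq_zero_of_natDegree_lt (by omega)
  refine ⟨(degree_lt_iff_coeff_zero _ _).2 hlt, ?_⟩
  ext i
  rw [coeff_reflect]
  rcases le_or_gt i (n - 1) with hi | hi
  · rw [revAt_le hi]
    rcases Nat.eq_zero_or_pos n with rfl | hn
    · rw [hlt _ (by omega), hlt _ (by omega)]
    · rw [coeff_divX, coeff_divX, ← hco (i + 1) (by omega)]
      congr 1; omega
  · rw [revAt_eq_self_of_lt hi]

theorem IsRealRooted.of_X_mul {p : ℝ[X]} (h : IsRealRooted (X * p)) : IsRealRooted p := by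
  rcases h with h | h
  · exact Or.inl ((mul_eq_zero.1 h).resolve_left X_ne_zero)
  · exact Or.inr fun z hz => h z (by simp [hz])

section PartialSums

variable {n r : ℕ} {c : ℕ → ℝ}

theorem sum_range_eq_of_le (hc : ∀ j, n + 1 < j → c j = 0) {k : ℕ} (hk : n + 2 ≤ k) :
    ∑ j ∈ range k, c j = ∑ j ∈ range (n + 2), c j := by
  refine (sum_subset (range_mono hk) fun j _ hj => hc j ?_).symm
  rw [mem_range] at hj; omega

theorem monotone_sum_range (hnn : ∀ j, 0 ≤ c j) : Monotone fun k => ∑ j ∈ range k, c j :=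
  fun _ _ h => sum_le_sum_of_subset_of_nonneg (range_mono h) fun _ _ _ => hnn _

theorem sum_range_le_total (hnn : ∀ j, 0 ≤ c j) (hc : ∀ j, n + 1 < j → c j = 0) (k : ℕ) :
    ∑ j ∈ range k, c j ≤ ∑ j ∈ range (n + 2), c j := by
  rcases le_total k (n + 2) with h | h
  · exact monotone_sum_range hnn h
  · exact (sum_range_eq_of_le hc h).le

theorem sum_range_comp_sub {N i : ℕ} (hi : i ≤ N + 1) :
    ∑ k ∈ range i, c (N - k) = ∑ j ∈ range (N + 1), c j - ∑ j ∈ range (N + 1 - i), c j := by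
  induction i with
  | zero => simp
  | succ i ih =>
    rw [sum_range_succ, ih (by omega), show N + 1 - i = N - i + 1 by omega,
      sum_range_succ c (N - i), show N + 1 - (i + 1) = N - i by omega]
    ring

theorem hasSymmDecomp_of_le (hnr : n + 1 ≤ r) (hnn : ∀ j, 0 ≤ c j)
    (hc : ∀ j, n + 1 < j → c j = 0)
    (hle : ∀ i ≤ (n + 1) / 2, ∑ k ∈ range (i + 1), c k ≤ ∑ k ∈ range (i + 1), c (n + 1 - k)) :
    HasNonnegRealRootedSymmDecomp (n + 1)
      (∑ j ∈ range (n + 2), C (c j) * edgewiseMonomial r (n + 1) j) := by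
  have hr : 1 ≤ r := by omega
  set s : ℕ → ℝ := fun k => ∑ j ∈ range k, c j with hs
  have hmono : Monotone s := monotone_sum_range hnn
  have hs0 : ∀ k, 0 ≤ s k := fun k => sum_nonneg fun _ _ => hnn _
  have htop : ∀ k, n + 2 ≤ k → s k = s (n + 2) := fun k => sum_range_eq_of_le hc
  set β : ℕ → ℝ := fun i => s (n + 2) - s (i + 1) - s (n + 1 - i) with hβ
  have hβtop : ∀ i, n + 1 ≤ i → β i = 0 := by
    intro i hi
    simp only [hβ]
    rw [htop (i + 1) (by omega), Nat.sub_eq_zero_of_le hi]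
    simp only [hs, sum_range_zero, sub_self]
  have hβsymm : ∀ i ≤ n, β (n - i) = β i := by
    intro i hi
    simp only [hβ]
    rw [show n - i + 1 = n + 1 - i by omega, show n + 1 - (n - i) = i + 1 by omega]
    ring
  have hβlow : ∀ i ≤ (n + 1) / 2, 0 ≤ β i := by
    intro i hi
    have := hle i hi
    rw [sum_range_comp_sub (by omega), show n + 1 + 1 - (i + 1) = n + 1 - i by omega] at this
    simp only [hβ, hs]
    linarith
  have hβnn : ∀ i, 0 ≤ β i := by
    intro i
    rcases le_or_gt i ((n + 1) / 2) with h | h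
    · exact hβlow i h
    · rcases le_or_gt i n with h' | h'
      · rw [← hβsymm i h']; exact hβlow _ (by omega)
      · exact (hβtop i h').ge
  refine ⟨∑ i ∈ range r, (C (s (i + 1)) + C (s (n + 1 - i)) * X) * edgewiseMonomial r n i,
    ∑ i ∈ range r, C (β i) * edgewiseMonomial r n i, ⟨?_, ?_, ?_, ?_, ?_⟩, ?_, ?_, ?_, ?_⟩
  · rw [sum_C_mul_edgewiseMonomial_succ hr hnr c hc, mul_sum, ← sum_add_distrib]
    refine sum_congr rfl fun i _ => ?_
    simp only [hβ, hs, map_sub]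
    ring
  · refine natDegree_le_iff_degree_le.1 (natDegree_sum_edgewiseMonomial_le hnr fun i hi => ?_)
    simp [hs, Nat.sub_eq_zero_of_le hi]
  · refine (natDegree_le_iff_degree_le.1
      (natDegree_sum_C_mul_edgewiseMonomial_le hr hβtop)).trans_lt ?_
    exact_mod_cast Nat.lt_succ_self n
  · refine reflect_sum_edgewiseMonomial (f := fun i => s (i + 1)) (g := fun i => s (n + 1 - i))
      hnr (fun i hi => ?_) (fun i hi => ?_) fun i hi => ?_
    · congr 1; omega
    · simp [hs, Nat.sub_eq_zero_of_le hi]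
    · rw [htop (i + 1) (by omega)]
  · exact reflect_sum_C_mul_edgewiseMonomial hnr hβsymm hβtop
  · exact HasNonnegCoeffs.sum fun i _ =>
      (edgewiseMonomial_coeff_nonneg r n i).linear_mul (hs0 _) (hs0 _)
  · exact HasNonnegCoeffs.sum fun i _ => (edgewiseMonomial_coeff_nonneg r n i).C_mul (hβnn i)
  · exact isRealRooted_sum_edgewiseMonomial hr n (f := fun i => s (i + 1))
      (g := fun i => s (n + 1 - i)) (fun _ _ h => hmono (by omega))
      (fun _ _ h => hmono (by omega)) (fun _ => hs0 _) fun _ => hs0 _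
  · exact isRealRooted_sum_C_mul_edgewiseMonomial hr n hβnn

theorem hasSymmDecomp_of_ge (hnr : n + 1 ≤ r) (hnn : ∀ j, 0 ≤ c j)
    (hc : ∀ j, n < j → c j = 0)
    (hge : ∀ i, 1 ≤ i → i ≤ (n + 1) / 2 →
      ∑ k ∈ Icc 1 i, c (n + 1 - k) ≤ ∑ k ∈ range (i + 1), c k) :
    HasNonnegRealRootedSymmDecomp n
      (∑ j ∈ range (n + 2), C (c j) * edgewiseMonomial r (n + 1) j) := by
  have hr : 1 ≤ r := by omega
  have hc' : ∀ j, n + 1 < j → c j = 0 := fun j hj => hc j (by omega)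
  set s : ℕ → ℝ := fun k => ∑ j ∈ range k, c j with hs
  have hmono : Monotone s := monotone_sum_range hnn
  have hle : ∀ k, s k ≤ s (n + 2) := sum_range_le_total hnn hc'
  have htop : ∀ k, n + 2 ≤ k → s k = s (n + 2) := fun k => sum_range_eq_of_le hc'
  have hlast : s (n + 1) = s (n + 2) := by
    simp only [hs]
    rw [sum_range_succ c (n + 1), hc (n + 1) (by omega), add_zero]
  have hs0 : s 0 = 0 := sum_range_zero _
  set α : ℕ → ℝ := fun i => s (i + 1) + s (n + 1 - i) - s (n + 2) with hα
  have hαtop : ∀ i, n + 1 ≤ i → α i = 0 := by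
    intro i hi
    simp only [hα]
    rw [htop (i + 1) (by omega), Nat.sub_eq_zero_of_le hi, hs0]
    ring
  have hαsymm : ∀ i ≤ n, α (n - i) = α i := by
    intro i hi
    simp only [hα]
    rw [show n - i + 1 = n + 1 - i by omega, show n + 1 - (n - i) = i + 1 by omega]
    ring
  have hαlow : ∀ i ≤ (n + 1) / 2, 0 ≤ α i := by
    intro i hi
    rcases Nat.eq_zero_or_pos i with rfl | hpos
    · simp only [hα, Nat.sub_zero, hlast, add_sub_cancel_right]
      exact sum_nonneg fun _ _ => hnn _
    · have := hge i hpos hi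
      have hshift : ∑ k ∈ Icc 1 i, c (n + 1 - k) = ∑ k ∈ range i, c (n - k) := by
        rw [← Ico_add_one_right_eq_Icc, sum_Ico_eq_sum_range]
        exact sum_congr rfl fun k _ => by congr 1; omega
      rw [hshift, sum_range_comp_sub (by omega)] at this
      simp only [hα, ← hlast]
      linarith
  have hαnn : ∀ i, 0 ≤ α i := by
    intro i
    rcases le_or_gt i ((n + 1) / 2) with h | h
    · exact hαlow i h
    · rcases le_or_gt i n with h' | h'
      · rw [← hαsymm i h']; exact hαlow _ (by omega)
      · exact (hαtop i h').ge
  set y := ∑ i ∈ range r, (C (s (n + 2) - s (n + 1 - i)) + C (s (n + 2) - s (i + 1)) * X) *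
    edgewiseMonomial r n i with hy
  have hgtop : ∀ i, n + 1 ≤ i → s (n + 2) - s (i + 1) = 0 := fun i hi => by
    rw [htop (i + 1) (by omega), sub_self]
  have hydeg : y.natDegree ≤ n + 1 := natDegree_sum_edgewiseMonomial_le hnr hgtop
  have hysymm : y.reflect (n + 1) = y := by
    refine reflect_sum_edgewiseMonomial (f := fun i => s (n + 2) - s (n + 1 - i))
      (g := fun i => s (n + 2) - s (i + 1)) hnr (fun i hi => ?_) hgtop fun i hi => ?_
    · rw [show n + 1 - (n - i) = i + 1 by omega]
    · rw [Nat.sub_eq_zero_of_le hi, Nat.sub_self]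
  have hy0 : y.coeff 0 = 0 := by
    rw [hy, finsetSum_coeff]
    refine sum_eq_zero fun i _ => ?_
    rw [mul_coeff_zero]
    rcases Nat.eq_zero_or_pos i with rfl | hpos
    · simp [hlast]
    · rw [edgewiseMonomial_coeff_zero hr n hpos, mul_zero]
  have hXy : X * y.divX = y := by
    conv_rhs => rw [← X_mul_divX_add y, hy0, C_0, add_zero]
  have hynn : HasNonnegCoeffs y := HasNonnegCoeffs.sum fun i _ =>
    (edgewiseMonomial_coeff_nonneg r n i).linear_mul (sub_nonneg.2 (hle _)) (sub_nonneg.2 (hle _))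
  have hyreal : IsRealRooted y :=
    isRealRooted_sum_edgewiseMonomial hr n (f := fun i => s (n + 2) - s (n + 1 - i))
      (g := fun i => s (n + 2) - s (i + 1))
      (fun _ _ h => sub_le_sub_left (hmono (by omega)) _)
      (fun _ _ h => sub_le_sub_left (hmono (by omega)) _)
      (fun _ => sub_nonneg.2 (hle _)) fun _ => sub_nonneg.2 (hle _)
  obtain ⟨hbdeg, hbsymm⟩ := reflect_divX hydeg hysymm hy0
  refine ⟨∑ i ∈ range r, C (α i) * edgewiseMonomial r n i, y.divX,
    ⟨?_, ?_, hbdeg, ?_, hbsymm⟩, ?_, ?_, ?_, ?_⟩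
  · rw [hXy, hy, sum_C_mul_edgewiseMonomial_succ hr hnr c hc', ← sum_add_distrib]
    refine sum_congr rfl fun i _ => ?_
    simp only [hα, hs, map_sub, map_add]
    ring
  · exact natDegree_le_iff_degree_le.1 (natDegree_sum_C_mul_edgewiseMonomial_le hr hαtop)
  · exact reflect_sum_C_mul_edgewiseMonomial hnr hαsymm hαtop
  · exact HasNonnegCoeffs.sum fun i _ => (edgewiseMonomial_coeff_nonneg r n i).C_mul (hαnn i)
  · intro i
    rw [coeff_divX]
    exact hynn _
  · exact isRealRooted_sum_C_mul_edgewiseMonomial hr n hαnn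
  · exact (hXy.symm ▸ hyreal : IsRealRooted (X * y.divX)).of_X_mul

end PartialSums

theorem hasSymmDecomp_of_degree_le_zero {p : ℝ[X]} (hdeg : p.degree ≤ (0 : ℕ))
    (hp : HasNonnegCoeffs p) : HasNonnegRealRootedSymmDecomp 0 p := by
  have hpC : p = C (p.coeff 0) := eq_C_of_degree_le_zero (by simpa using hdeg)
  refine ⟨p, 0, ⟨by simp, hdeg, by simp, ?_, by simp⟩, hp, fun i => by simp, ?_, Or.inl rfl⟩
  · rw [hpC, reflect_C]; simp
  · refine isRealRooted_of_upperHalfPlane fun z _ h => ?_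
    rw [hpC] at h ⊢
    simpa using h

end SymmetricDecomposition

open Polynomial in
theorem theorem1p2 (n : ℕ) (h : Polynomial ℝ) (hdeg : h.degree ≤ n) (hnn : HasNonnegCoeffs h) :
    (∀ r : ℕ, 1 ≤ r →
      (edgewiseOp n r h).degree ≤ n ∧
      overOneSubPow n (edgewiseOp n r h) = veroneseSection r 0 (overOneSubPow n h) ∧
      ∀ q : Polynomial ℝ, overOneSubPow n q = veroneseSection r 0 (overOneSubPow n h) →
        q = edgewiseOp n r h) ∧
    ((∀ i : ℕ, i ≤ n / 2 →
        ∑ k ∈ Finset.range (i + 1), h.coeff k ≤ ∑ k ∈ Finset.range (i + 1), h.coeff (n - k)) →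
      ∀ r : ℕ, 1 ≤ r → n ≤ r → HasNonnegRealRootedSymmDecomp n (edgewiseOp n r h)) ∧
    (h.coeff n = 0 →
      (∀ i : ℕ, 1 ≤ i → i ≤ n / 2 →
        ∑ k ∈ Finset.Icc 1 i, h.coeff (n - k) ≤ ∑ k ∈ Finset.range (i + 1), h.coeff k) →
      ∀ r : ℕ, 1 ≤ r → n ≤ r → HasNonnegRealRootedSymmDecomp (n - 1) (edgewiseOp n r h)) := by
  have hc : ∀ j, n < j → h.coeff j = 0 := fun j hj =>
    coeff_eq_zero_of_degree_lt (hdeg.trans_lt (by exact_mod_cast hj))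
  have hdegree : ∀ r, 1 ≤ r → (edgewiseOp n r h).degree ≤ n := fun r hr => by
    rw [edgewiseOp_eq_sum hr hdeg]
    exact natDegree_le_iff_degree_le.1 (sum_edgewiseMonomial_natDegree_le hr n h.coeff)
  refine ⟨fun r hr => ⟨hdegree r hr, ?_, fun q hq => ?_⟩, fun hle r hr hnr => ?_,
    fun hn hge r hr hnr => ?_⟩
  · rw [edgewiseOp_eq_sum hr hdeg, overOneSubPow_sum_edgewiseMonomial hr hdeg]
  · refine overOneSubPow_injective n ?_
    rw [hq, edgewiseOp_eq_sum hr hdeg, overOneSubPow_sum_edgewiseMonomial hr hdeg]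
  all_goals
    have hp : HasNonnegCoeffs (edgewiseOp n r h) := by
      rw [edgewiseOp_eq_sum hr hdeg]
      exact HasNonnegCoeffs.sum fun i _ => (edgewiseMonomial_coeff_nonneg r n i).C_mul (hnn i)
    have hd := hdegree r hr
  · cases n with
    | zero => exact hasSymmDecomp_of_degree_le_zero hd hp
    | succ n =>
      rw [edgewiseOp_eq_sum hr hdeg]
      exact hasSymmDecomp_of_le hnr hnn hc hle
  · cases n with
    | zero => exact hasSymmDecomp_of_degree_le_zero hd hp
    | succ n =>
      rw [edgewiseOp_eq_sum hr hdeg]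
      refine hasSymmDecomp_of_ge hnr hnn (fun j hj => ?_) hge
      rcases (Nat.succ_le_of_lt hj).eq_or_lt with rfl | hj
      · exact hn
      · exact hc j hj
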